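/- Let $N\ge 3$ be an integer, let $\alpha, C, k, h$ be real constants with $h\neq 0$, let $I\subseteq\mathbb R$ be an open interval and let $f:I\to\mathbb R$ be a $C^2$ function that does not vanish identically. Consider the $N$-dimensional metric $$ds^2=-f(r)\,dt^2+f(r)^{-1}dr^2+h^2\,d\Omega_{N-2}^2 ,$$ where $d\Omega_{N-2}^2$ is the metric of the unit sphere $S^{N-2}$, at all points with $r\in I$ and $f(r)\ne 0$, and the energy-momentum tensor $T^a{}_b=C\,\mathrm{diag}[-1,-1,k,\dots,k]$ (in the order $t,r$, sphere). The Einstein–Gauss–Bonnet equations are $G_{ab}+\alpha\,G^{GB}_{ab}=T_{ab}$, where $G_{ab}=R_{ab}-\tfrac12Rg_{ab}$ and $$G^{GB}_{ab}=2\left(R_{acde}R_b{}^{cde}-2R_{acbd}R^{cd}-2R_{ac}R^c{}_b+RR_{ab}\right)-\tfrac12\left(R_{cdef}R^{cdef}-4R_{cd}R^{cd}+R^2\right)g_{ab}.$$ (1) These equations hold at all such points if and only if $h$ satisfies the algebraic constraint $$2Ch^4-(N-3)(N-2)h^2-\alpha(N-2)(N-3)(N-4)(N-5)=0$$ and, for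 all $r\in I$, $$h^2\left(h^2+2\alpha(N-3)(N-4)\right)f''(r)-(N-3)(N-4)h^2-\alpha(N-3)(N-4)(N-5)(N-6)=2kCh^4 .$$ (2) If $h^2+2\alpha(N-3)(N-4)\neq0$ (which is automatic for $\alpha\ge0$), then the equations hold at all such points if and only if $h$ satisfies the above constraint and there are constants $C_1,C_2\in\mathbb R$ such that, for all $r\in I$, $$f(r)=\frac{2kCh^4+(N-3)(N-4)h^2+\alpha(N-3)(N-4)(N-5)(N-6)}{2h^2\left(h^2+2\alpha(N-3)(N-4)\right)}\,r^2+C_1r+C_2 .$$ In particular $f$ is a quadratic polynomial whose $r^2$ coefficient is determined by $C$, $k$, $N$, $\alpha$ and the constant $h$. -/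

import Mathlib

open scoped Matrix

noncomputable section

namespace EGB

/-! ### Curvature in a coordinate chart

`ι` indexes the coordinates, and a metric is the matrix field `g` of its components. -/

section Curvature

variable {ι : Type*} [Fintype ι] [DecidableEq ι]

/-- The partial derivative `∂_i F` at `x`. -/
def pd (i : ι) (F : (ι → ℝ) → ℝ) (x : ι → ℝ) : ℝ :=
  fderiv ℝ F x (Pi.single i 1)

/-- The inverse metric `g^{ab}`. -/
def ginv (g : (ι → ℝ) → Matrix ι ι ℝ) (x : ι → ℝ) (a b : ι) : ℝ :=
  (g x)⁻¹ a b

/-- Christoffel symbols `Γ^a_{bc}` of the Levi-Civita connection. -/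
def christoffel (g : (ι → ℝ) → Matrix ι ι ℝ) (a b c : ι) (x : ι → ℝ) : ℝ :=
  (1 / 2) * ∑ d, ginv g x a d *
    (pd b (fun y => g y d c) x + pd c (fun y => g y d b) x - pd d (fun y => g y b c) x)

/-- The Riemann tensor
`R^a_{bcd} = ∂_c Γ^a_{db} - ∂_d Γ^a_{cb} + Γ^a_{ce} Γ^e_{db} - Γ^a_{de} Γ^e_{cb}`. -/
def riemann (g : (ι → ℝ) → Matrix ι ι ℝ) (x : ι → ℝ) (a b c d : ι) : ℝ :=
  pd c (christoffel g a d b) x - pd d (christoffel g a c b) x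
    + ∑ e, (christoffel g a c e x * christoffel g e d b x
      - christoffel g a d e x * christoffel g e c b x)

/-- The Riemann tensor `R_{abcd}`. -/
def riemannLow (g : (ι → ℝ) → Matrix ι ι ℝ) (x : ι → ℝ) (a b c d : ι) : ℝ :=
  ∑ e, g x a e * riemann g x e b c d

/-- The Riemann tensor `R^{abc}{}_d` with its first three indices raised. -/
def riemannUp3 (g : (ι → ℝ) → Matrix ι ι ℝ) (x : ι → ℝ) (a b c d : ι) : ℝ :=
  ∑ p, ∑ q, ginv g x b p * ginv g x c q * riemann g x a p q d

/-- The Riemann tensor `R^{abcd}`. -/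
def riemannUp (g : (ι → ℝ) → Matrix ι ι ℝ) (x : ι → ℝ) (a b c d : ι) : ℝ :=
  ∑ s, ginv g x d s * riemannUp3 g x a b c s

/-- The Ricci tensor `R_{ab} = R^c_{acb}`. -/
def ricci (g : (ι → ℝ) → Matrix ι ι ℝ) (x : ι → ℝ) (a b : ι) : ℝ :=
  ∑ c, riemann g x c a c b

/-- The Ricci tensor `R^a_b`. -/
def ricciMixed (g : (ι → ℝ) → Matrix ι ι ℝ) (x : ι → ℝ) (a b : ι) : ℝ :=
  ∑ p, ginv g x a p * ricci g x p b

/-- The Ricci tensor `R^{ab}`. -/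
def ricciUp (g : (ι → ℝ) → Matrix ι ι ℝ) (x : ι → ℝ) (a b : ι) : ℝ :=
  ∑ q, ginv g x b q * ricciMixed g x a q

/-- The scalar curvature. -/
def scalarCurv (g : (ι → ℝ) → Matrix ι ι ℝ) (x : ι → ℝ) : ℝ :=
  ∑ a, ricciMixed g x a a

/-- The Einstein tensor `R_{ab} - R g_{ab} / 2`. -/
def einstein (g : (ι → ℝ) → Matrix ι ι ℝ) (x : ι → ℝ) (a b : ι) : ℝ :=
  ricci g x a b - (1 / 2) * scalarCurv g x * g x a b

/-- The Gauss–Bonnet Lagrangian `R_{abcd} R^{abcd} - 4 R_{ab} R^{ab} + R²`. -/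
def lagrangianGB (g : (ι → ℝ) → Matrix ι ι ℝ) (x : ι → ℝ) : ℝ :=
  (∑ a, ∑ b, ∑ c, ∑ d, riemannLow g x a b c d * riemannUp g x a b c d)
    - 4 * (∑ a, ∑ b, ricci g x a b * ricciUp g x a b) + scalarCurv g x ^ 2

/-- The Gauss–Bonnet tensor
`2 (- R_{mabc} R^{bca}{}_n - 2 R_{manb} R^{ab} - 2 R_{ma} R^a_n + R R_{mn}) - L_GB g_{mn} / 2`. -/
def gaussBonnet (g : (ι → ℝ) → Matrix ι ι ℝ) (x : ι → ℝ) (m n : ι) : ℝ :=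
  2 * (-(∑ a, ∑ b, ∑ c, riemannLow g x m a b c * riemannUp3 g x b c a n)
      - 2 * (∑ a, ∑ b, riemannLow g x m a n b * ricciUp g x a b)
      - 2 * (∑ a, ricci g x m a * ricciMixed g x a n)
      + scalarCurv g x * ricci g x m n)
    - (1 / 2) * lagrangianGB g x * g x m n

/-- The Einstein–Gauss–Bonnet equations `G_{ab} + α G^{GB}_{ab} = T_{ab}` at the point `x`, for the
energy-momentum tensor with mixed components `T^a_b`. -/
def FieldEquationsAt (g : (ι → ℝ) → Matrix ι ι ℝ) (α : ℝ) (T : Matrix ι ι ℝ) (x : ι → ℝ) : Prop :=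
  ∀ a b, einstein g x a b + α * gaussBonnet g x a b = ∑ c, g x a c * T c b

end Curvature

/-! ### The round sphere in stereographic coordinates -/

/-- Inverse stereographic projection `ℝⁿ → Sⁿ ⊆ ℝⁿ⁺¹`,
`y ↦ (2 y / (1 + |y|²), (|y|² - 1) / (1 + |y|²))`, a parametrization of the unit sphere minus its
north pole. The coordinate `none` is the last one. -/
def invStereo {n : ℕ} (y : Fin n → ℝ) : Option (Fin n) → ℝ
  | some i => 2 * y i / (1 + ∑ j, y j ^ 2)
  | none => ((∑ j, y j ^ 2) - 1) / (1 + ∑ j, y j ^ 2)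

/-- The line element `dΩ²_n` of the unit sphere: the Euclidean metric of `ℝⁿ⁺¹` pulled back along
`invStereo`. -/
def sphereMetric {n : ℕ} (y : Fin n → ℝ) : Matrix (Fin n) (Fin n) ℝ :=
  fun i j => ∑ a, pd i (fun z => invStereo z a) y * pd j (fun z => invStereo z a) y

theorem invStereo_mem_sphere {n : ℕ} (y : Fin n → ℝ) : ∑ a, invStereo y a ^ 2 = 1 := by
  have hs : (0 : ℝ) ≤ ∑ j, y j ^ 2 := Finset.sum_nonneg fun j _ => sq_nonneg _
  have h1 : (1 + ∑ j, y j ^ 2) ≠ 0 := by positivity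
  have h2 : ∑ i, invStereo y (some i) ^ 2 = 4 * (∑ j, y j ^ 2) / (1 + ∑ j, y j ^ 2) ^ 2 := by
    rw [Finset.mul_sum, Finset.sum_div]
    refine Finset.sum_congr rfl fun i _ => ?_
    simp only [invStereo]
    rw [div_pow]
    ring
  rw [Fintype.sum_option, h2]
  simp only [invStereo]
  field_simp
  ring

theorem sphereMetric_eq {n : ℕ} (y : Fin n → ℝ) (i j : Fin n) :
    sphereMetric y i j = if i = j then 4 / (1 + ∑ l, y l ^ 2) ^ 2 else 0 := by
  have hs : (0 : ℝ) ≤ ∑ j, y j ^ 2 := Finset.sum_nonneg fun j _ => sq_nonneg _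
  have h1 : (1 + ∑ j, y j ^ 2) ≠ 0 := by positivity
  have hc : ∀ a : Fin n, HasFDerivAt (fun z : Fin n → ℝ => z a)
      (ContinuousLinearMap.proj (R := ℝ) (φ := fun _ : Fin n => ℝ) a) y :=
    fun a => hasFDerivAt_apply a y
  have hq := HasFDerivAt.fun_sum (u := Finset.univ) (fun a _ => (hc a).pow 2)
  have hi := (hasDerivAt_inv h1).comp_hasFDerivAt y (hq.const_add 1)
  have e1 : ∀ a b : Fin n, pd b (fun z => invStereo z (some a)) y
      = (if a = b then 2 / (1 + ∑ l, y l ^ 2) else 0)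
        - 4 * y a * y b / (1 + ∑ l, y l ^ 2) ^ 2 := by
    intro a b
    have := (((hc a).const_mul 2).mul hi).fderiv
    simp only [pd, invStereo, div_eq_mul_inv]
    erw [this]
    by_cases hab : a = b
    · subst hab
      simp [Pi.single_apply]
      field_simp
      ring
    · simp [Pi.single_apply, hab]
      field_simp
      ring
  have e2 : ∀ b : Fin n, pd b (fun z => invStereo z none) y
      = 4 * y b / (1 + ∑ l, y l ^ 2) ^ 2 := by
    intro b
    have := ((hq.sub_const 1).mul hi).fderiv
    simp only [pd, invStereo, div_eq_mul_inv]
    erw [this]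
    simp [Pi.single_apply]
    field_simp
    ring
  have e3 : ∑ a, y a * y a = ∑ l, y l ^ 2 := Finset.sum_congr rfl fun a _ => by ring
  have e4 : ∑ a, pd i (fun z => invStereo z (some a)) y * pd j (fun z => invStereo z (some a)) y
      = (if i = j then 4 / (1 + ∑ l, y l ^ 2) ^ 2 else 0)
        - 16 * y i * y j / (1 + ∑ l, y l ^ 2) ^ 3
        + 16 * y i * y j / (1 + ∑ l, y l ^ 2) ^ 4 * ∑ a, y a * y a := by
    set D := 1 + ∑ l, y l ^ 2 with hD
    have : ∀ a, pd i (fun z => invStereo z (some a)) y * pd j (fun z => invStereo z (some a)) y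
        = (if a = i then (if i = j then 4 / D ^ 2 else 0) - 8 * y i * y j / D ^ 3 else 0)
          - (if a = j then 8 * y i * y j / D ^ 3 else 0)
          + 16 * y i * y j / D ^ 4 * (y a * y a) := by
      intro a
      rw [e1 a i, e1 a j]
      by_cases h2 : a = i
      · subst h2
        by_cases h3 : a = j
        · subst h3
          simp
          field_simp
          ring
        · simp [h3]
          field_simp
          ring
      · by_cases h3 : a = j
        · subst h3
          simp [h2]
          field_simp
          ring
        · simp [h2, h3]
          field_simp
          ring
    rw [Finset.sum_congr rfl fun a _ => this a, Finset.sum_add_distrib, Finset.sum_sub_distrib,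
      ← Finset.mul_sum]
    simp only [Finset.sum_ite_eq', Finset.mem_univ, if_true]
    ring
  rw [sphereMetric, Fintype.sum_option, e4, e2, e2, e3]
  field_simp
  split_ifs
  · field_simp
    ring
  · ring

/-! ### The Bertotti–Robinson type ansatz -/

/-- The metric `-f(r) dt² + f(r)⁻¹ dr² + h² dΩ²_n`, where `t = x (inl 0)`, `r = x (inl 1)` and the
coordinates `x (inr i)` are stereographic coordinates on the unit sphere. -/
def brMetric (n : ℕ) (f : ℝ → ℝ) (h : ℝ) (x : Fin 2 ⊕ Fin n → ℝ) :
    Matrix (Fin 2 ⊕ Fin n) (Fin 2 ⊕ Fin n) ℝ :=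
  Matrix.fromBlocks
    (Matrix.diagonal ![-f (x (Sum.inl 1)), (f (x (Sum.inl 1)))⁻¹]) 0
    0 (h ^ 2 • sphereMetric (fun i => x (Sum.inr i)))

/-- The energy-momentum tensor `T^a_b = C [-1, -1, k, …, k]`. -/
def brStress (n : ℕ) (C k : ℝ) : Matrix (Fin 2 ⊕ Fin n) (Fin 2 ⊕ Fin n) ℝ :=
  Matrix.diagonal (Sum.elim (fun _ => C * (-1)) (fun _ => C * k))

/-- The `N`-dimensional metric `-f dt² + f⁻¹ dr² + h² dΩ²_{N-2}` with `r ∈ I` solves the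
Einstein–Gauss–Bonnet equations with source `T^a_b = C [-1, -1, k, …, k]`, wherever it is defined,
that is, at all points with `r ∈ I` and `f r ≠ 0`. -/
def SolvesEGB (N : ℕ) (α C k h : ℝ) (f : ℝ → ℝ) (I : Set ℝ) : Prop :=
  ∀ x : Fin 2 ⊕ Fin (N - 2) → ℝ, x (Sum.inl 1) ∈ I → f (x (Sum.inl 1)) ≠ 0 →
    FieldEquationsAt (brMetric (N - 2) f h) α (brStress (N - 2) C k) x

end EGB

end

/-! In the coordinates (t, r, stereographic) the metric is diagonal, and its Riemann tensor is
determined by one number `K a b` for each coordinate plane: -f''/2 for the t-r plane, 1/h² for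
planes tangent to the sphere, and 0 for mixed planes, since the metric is a product. For any
curvature of this form every contraction in the field equations collapses to sums of `K`,
off-diagonal equations are trivial, and each diagonal one can be divided by its metric component
(`HasDiagonalCurvature.fieldEquationsAt_iff`).

For the product metric this leaves two scalar equations. In the t and r components f'' cancels, as
the Einstein tensor of a surface vanishes, and what remains is the constraint on h. The sphere
components all coincide and are affine in f''.

The equations are imposed only where f ≠ 0, yet the conclusion concerns all of I. Where the
coefficient of f'' is nonzero, f'' equals a constant c off the zeros of f. At a zero of f, either f
vanishes nearby and f'' = 0, or nearby nonzero values force f'' = c by continuity. A continuous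
function on a connected set with values in {c, 0} is constant, and a point with f ≠ 0 fixes the
value c (`deriv_deriv_eq_of_ne_zero`). Integrating twice gives the quadratics. -/

namespace EGB

/-! ### Curvature contractions for a diagonal metric -/

section Diagonal

variable {ι : Type*} [Fintype ι] [DecidableEq ι]

theorem ginv_diagonal {g : (ι → ℝ) → Matrix ι ι ℝ} {x u : ι → ℝ} (hu : ∀ a, u a ≠ 0)
    (hg : g x = Matrix.diagonal u) (a b : ι) :
    ginv g x a b = if a = b then (u a)⁻¹ else 0 := by
  have h : (g x)⁻¹ = Matrix.diagonal (fun a => (u a)⁻¹) := by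
    rw [hg]
    apply Matrix.inv_eq_right_inv
    rw [Matrix.diagonal_mul_diagonal]
    simp [hu]
  rw [ginv, h, Matrix.diagonal_apply]

theorem christoffel_diagonal {g : (ι → ℝ) → Matrix ι ι ℝ} {u : ι → (ι → ℝ) → ℝ} {x : ι → ℝ}
    (hg : ∀ y, g y = Matrix.diagonal (fun a => u a y)) (hu : ∀ a, u a x ≠ 0) (a b c : ι) :
    christoffel g a b c x = (1 / 2) * (u a x)⁻¹ *
      ((if a = c then pd b (u a) x else 0) + (if a = b then pd c (u a) x else 0)
        - (if b = c then pd a (u b) x else 0)) := by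
  have h0 : ∀ i, pd i (fun _ : ι → ℝ => (0 : ℝ)) x = 0 := fun i => by simp [pd]
  have h1 : ∀ i a b, pd i (fun y => g y a b) x = if a = b then pd i (u a) x else 0 := by
    intro i a b
    by_cases hab : a = b
    · subst hab; simp [hg]
    · simp [hg, hab, h0]
  simp only [christoffel, ginv_diagonal hu (hg x), h1, ite_mul, zero_mul, Finset.sum_ite_eq,
    Finset.mem_univ, if_true]
  ring

/-- The sectional curvatures `K` of the coordinate planes determine the curvature tensor at `x`,
where the metric is `diag u`. -/
structure HasDiagonalCurvature (g : (ι → ℝ) → Matrix ι ι ℝ) (x u : ι → ℝ) (K : ι → ι → ℝ) :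
    Prop where
  ne_zero : ∀ a, u a ≠ 0
  metric : g x = Matrix.diagonal u
  symm : ∀ a b, K a b = K b a
  -- A normalization: the formula for `riemann` vanishes for a = b whatever `K a a` is. With the
  -- value 0, sums over all indices need no condition a ≠ b.
  self : ∀ a, K a a = 0
  riemann : ∀ a b c d, riemann g x a b c d =
    K a b * u b * ((if a = c then if b = d then 1 else 0 else 0)
      - (if a = d then if b = c then 1 else 0 else 0))

namespace HasDiagonalCurvature

variable {g : (ι → ℝ) → Matrix ι ι ℝ} {x u : ι → ℝ} {K : ι → ι → ℝ}

theorem riemannLow (H : HasDiagonalCurvature g x u K) (a b c d : ι) :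
    riemannLow g x a b c d = u a * u b * K a b *
      ((if a = c then if b = d then 1 else 0 else 0)
        - (if a = d then if b = c then 1 else 0 else 0)) := by
  simp only [EGB.riemannLow, H.metric, Matrix.diagonal_apply, ite_mul, zero_mul, Finset.sum_ite_eq,
    Finset.mem_univ, if_true, H.riemann]
  ring

theorem riemannUp3 (H : HasDiagonalCurvature g x u K) (a b c d : ι) :
    riemannUp3 g x a b c d = (u c)⁻¹ * K a b *
      ((if a = c then if b = d then 1 else 0 else 0)
        - (if a = d then if b = c then 1 else 0 else 0)) := by
  simp only [EGB.riemannUp3, ginv_diagonal H.ne_zero H.metric, ite_mul, mul_ite, mul_zero,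
    zero_mul, Finset.sum_ite_eq, Finset.mem_univ, if_true, H.riemann]
  have := H.ne_zero b
  field_simp

theorem riemannUp (H : HasDiagonalCurvature g x u K) (a b c d : ι) :
    riemannUp g x a b c d = (u d)⁻¹ * (u c)⁻¹ * K a b *
      ((if a = c then if b = d then 1 else 0 else 0)
        - (if a = d then if b = c then 1 else 0 else 0)) := by
  simp only [EGB.riemannUp, ginv_diagonal H.ne_zero H.metric, ite_mul,
    zero_mul, Finset.sum_ite_eq, Finset.mem_univ, if_true, H.riemannUp3]
  ring

theorem ricci (H : HasDiagonalCurvature g x u K) (a b : ι) :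
    ricci g x a b = if a = b then u a * ∑ c, K a c else 0 := by
  have h : ∀ c, EGB.riemann g x c a c b = if a = b then u a * K a c else 0 := by
    intro c
    rw [H.riemann, H.symm c a]
    by_cases hab : a = b
    · subst hab
      by_cases hac : c = a
      · subst hac; simp [H.self]
      · simp [hac]; ring
    · by_cases hac : c = b
      · subst hac; simp [hab]
      · simp [hac, hab]
  simp only [EGB.ricci, h]
  split_ifs <;> simp [Finset.mul_sum]

theorem ricciMixed (H : HasDiagonalCurvature g x u K) (a b : ι) :
    ricciMixed g x a b = if a = b then ∑ c, K a c else 0 := by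
  simp only [EGB.ricciMixed, ginv_diagonal H.ne_zero H.metric, ite_mul,
    zero_mul, Finset.sum_ite_eq, Finset.mem_univ, if_true, H.ricci]
  simp [H.ne_zero a]

theorem ricciUp (H : HasDiagonalCurvature g x u K) (a b : ι) :
    ricciUp g x a b = if a = b then (u a)⁻¹ * ∑ c, K a c else 0 := by
  simp only [EGB.ricciUp, ginv_diagonal H.ne_zero H.metric, ite_mul,
    zero_mul, Finset.sum_ite_eq, Finset.mem_univ, if_true, H.ricciMixed]
  split_ifs with hab
  · rw [hab]
  · simp

theorem scalarCurv (H : HasDiagonalCurvature g x u K) :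
    scalarCurv g x = ∑ a, ∑ c, K a c := by
  simp [EGB.scalarCurv, H.ricciMixed]

theorem lagrangianGB (H : HasDiagonalCurvature g x u K) :
    lagrangianGB g x = 2 * (∑ a, ∑ b, K a b ^ 2) - 4 * (∑ a, (∑ c, K a c) ^ 2)
      + (∑ a, ∑ c, K a c) ^ 2 := by
  -- For a ≠ b only (c, d) = (a, b) and (c, d) = (b, a) contribute, each with `K a b ^ 2`; this is
  -- the source of the factor 2. For a = b both terms vanish by `H.self`.
  have h1 : ∀ a b c d, EGB.riemannLow g x a b c d * EGB.riemannUp g x a b c d =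
      (if a = c then if b = d then K a b ^ 2 else 0 else 0)
        + (if b = c then if a = d then K a b ^ 2 else 0 else 0) := by
    intro a b c d
    rw [H.riemannLow, H.riemannUp]
    have ha := H.ne_zero a
    have hb := H.ne_zero b
    by_cases hab : a = b
    · subst hab; simp [H.self]
    · by_cases h1 : a = c
      · subst h1
        by_cases h2 : b = d
        · subst h2; simp [hab, Ne.symm hab]; field_simp
        · simp [h2, Ne.symm hab]
      · by_cases h3 : b = c
        · subst h3
          by_cases h4 : a = d
          · subst h4; simp [hab]; field_simp
          · simp [h4, hab]
        · simp [h1, h3]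
  have h2 : ∀ a b, EGB.ricci g x a b * EGB.ricciUp g x a b =
      if a = b then (∑ c, K a c) ^ 2 else 0 := by
    intro a b
    have ha := H.ne_zero a
    rw [H.ricci, H.ricciUp]
    split_ifs
    · field_simp
    · simp
  simp only [EGB.lagrangianGB, h1, h2, H.scalarCurv, Finset.sum_add_distrib, Finset.sum_ite_eq,
    Finset.mem_univ, if_true]
  simp only [← Finset.sum_add_distrib, Finset.mul_sum, two_mul, Finset.sum_ite_irrel,
    Finset.sum_const_zero, Finset.sum_ite_eq, Finset.mem_univ, if_true]

theorem einstein (H : HasDiagonalCurvature g x u K) (a b : ι) :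
    einstein g x a b =
      if a = b then u a * (∑ c, K a c - (1 / 2) * ∑ d, ∑ c, K d c) else 0 := by
  rw [EGB.einstein, H.ricci, H.scalarCurv, H.metric, Matrix.diagonal_apply]
  split_ifs <;> ring

theorem gaussBonnet (H : HasDiagonalCurvature g x u K) (m n : ι) :
    gaussBonnet g x m n = if m = n then u m * (2 * (2 * (∑ a, K m a ^ 2)
      - 2 * (∑ a, K m a * ∑ c, K a c) - 2 * (∑ c, K m c) ^ 2
      + (∑ a, ∑ c, K a c) * ∑ c, K m c) - (1 / 2) * (2 * (∑ a, ∑ b, K a b ^ 2)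
      - 4 * (∑ a, (∑ c, K a c) ^ 2) + (∑ a, ∑ c, K a c) ^ 2)) else 0 := by
  -- The pair (b, c) must be (m, a) or (a, m). In both cases the two factors have opposite signs, so
  -- the leading minus sign in the Gauss–Bonnet tensor turns the sum into `+2 u m ∑ K m a ^ 2`.
  have h1 : ∀ a b c, EGB.riemannLow g x m a b c * EGB.riemannUp3 g x b c a n =
      - (if m = b then if a = c then if m = n then u m * K m a ^ 2 else 0 else 0 else 0)
        - (if a = b then if m = c then if m = n then u m * K m a ^ 2 else 0 else 0 else 0) := by
    intro a b c
    rw [H.riemannLow, H.riemannUp3]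
    have ha := H.ne_zero a
    by_cases hma : m = a
    · subst hma; simp [H.self]
    · by_cases hb : m = b
      · subst hb
        by_cases hc : a = c
        · subst hc
          by_cases hn : m = n
          · subst hn; simp [hma, Ne.symm hma]; field_simp
          · simp [hn, hma, Ne.symm hma]
        · simp [hc, Ne.symm hma]
      · by_cases hb' : a = b
        · subst hb'
          by_cases hc : m = c
          · subst hc
            by_cases hn : m = n
            · subst hn; simp [hma, H.symm a m]; field_simp
            · simp [hn, hma]
          · simp [hc, hma]
        · simp [hb, hb']
  have h2 : ∀ a b, EGB.riemannLow g x m a n b * EGB.ricciUp g x a b =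
      if a = b then if m = n then u m * (K m a * ∑ c, K a c) else 0 else 0 := by
    intro a b
    rw [H.riemannLow, H.ricciUp]
    have ha := H.ne_zero a
    by_cases hab : a = b
    · subst hab
      by_cases hma : m = a
      · subst hma; simp [H.self]
      · by_cases hn : m = n
        · subst hn; simp [hma]; field_simp
        · simp [hn, hma]
    · simp [hab]
  have h3 : ∀ a, EGB.ricci g x m a * EGB.ricciMixed g x a n =
      if m = a then if m = n then u m * (∑ c, K m c) ^ 2 else 0 else 0 := by
    intro a
    rw [H.ricci, H.ricciMixed]
    by_cases hma : m = a
    · subst hma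
      simp only [if_true]
      split_ifs <;> ring
    · simp [hma]
  rw [EGB.gaussBonnet]
  simp only [h1, h2, h3, H.scalarCurv, H.lagrangianGB]
  simp only [H.ricci, H.metric, Matrix.diagonal_apply]
  by_cases hmn : m = n
  · subst hmn
    simp only [if_true, Finset.sum_sub_distrib, Finset.sum_neg_distrib, Finset.sum_ite_eq,
      Finset.mem_univ, Finset.sum_ite_irrel, Finset.sum_const_zero, ← Finset.mul_sum]
    ring
  · simp [hmn]

theorem fieldEquationsAt_iff (H : HasDiagonalCurvature g x u K) (α : ℝ) (τ : ι → ℝ) :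
    FieldEquationsAt g α (Matrix.diagonal τ) x ↔ ∀ m,
      ∑ c, K m c - (1 / 2) * (∑ d, ∑ c, K d c) + α * (2 * (2 * (∑ a, K m a ^ 2)
      - 2 * (∑ a, K m a * ∑ c, K a c) - 2 * (∑ c, K m c) ^ 2
      + (∑ a, ∑ c, K a c) * ∑ c, K m c) - (1 / 2) * (2 * (∑ a, ∑ b, K a b ^ 2)
      - 4 * (∑ a, (∑ c, K a c) ^ 2) + (∑ a, ∑ c, K a c) ^ 2)) = τ m := by
  have h : ∀ a b, ∑ c, g x a c * Matrix.diagonal τ c b = if a = b then u a * τ a else 0 := by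
    intro a b
    simp only [H.metric, Matrix.diagonal_apply, ite_mul, zero_mul, Finset.sum_ite_eq,
      Finset.mem_univ, if_true]
    split_ifs <;> simp
  simp only [FieldEquationsAt, h, H.einstein, H.gaussBonnet]
  constructor
  · intro h m
    have := h m m
    simp only [if_true] at this
    apply mul_left_cancel₀ (H.ne_zero m)
    linear_combination this
  · intro h a b
    by_cases hab : a = b
    · simp only [hab, if_true]
      linear_combination u b * h b
    · simp [hab]

end HasDiagonalCurvature

end Diagonal

/-! ### Partial derivatives in coordinates -/

section PartialDerivative

variable {ι : Type*} [DecidableEq ι]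

theorem pd_eq_of_hasFDerivAt {F : (ι → ℝ) → ℝ} {F' : (ι → ℝ) →L[ℝ] ℝ} {x : ι → ℝ}
    (hF : HasFDerivAt F F' x) (i : ι) : pd i F x = F' (Pi.single i 1) := by
  rw [pd, hF.fderiv]

theorem pd_comp_apply [Fintype ι] {φ : ℝ → ℝ} {φ' : ℝ} {x : ι → ℝ} {j : ι} (hφ : HasDerivAt φ φ' (x j))
    (i : ι) : pd i (fun y => φ (y j)) x = if i = j then φ' else 0 := by
  have h := hφ.comp_hasFDerivAt x (hasFDerivAt_apply (𝕜 := ℝ) j x)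
  have h' := pd_eq_of_hasFDerivAt h i
  simp only [Function.comp_def] at h'
  rw [h']
  by_cases hij : i = j
  · subst hij; simp
  · simp [hij, Ne.symm hij]

theorem pd_const (i : ι) (c : ℝ) (x : ι → ℝ) : pd i (fun _ => c) x = 0 := by
  simp [pd]

theorem pd_congr {F G : (ι → ℝ) → ℝ} {x : ι → ℝ} (h : F =ᶠ[nhds x] G) (i : ι) :
    pd i F x = pd i G x := by
  rw [pd, pd, h.fderiv_eq]

end PartialDerivative

/-! ### Stereographic coordinates and the diagonal form of the metric -/

/-- The denominator `1 + |y|²` of stereographic coordinates. -/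
noncomputable def stereoDenom {n : ℕ} (x : Fin 2 ⊕ Fin n → ℝ) : ℝ := 1 + ∑ l, x (Sum.inr l) ^ 2

theorem stereoDenom_pos {n : ℕ} (x : Fin 2 ⊕ Fin n → ℝ) : 0 < stereoDenom x := by
  have : 0 ≤ ∑ l, x (Sum.inr l) ^ 2 := Finset.sum_nonneg fun j _ => sq_nonneg _
  rw [stereoDenom]
  linarith

theorem differentiableAt_stereoDenom {n : ℕ} (x : Fin 2 ⊕ Fin n → ℝ) :
    DifferentiableAt ℝ stereoDenom x := by
  unfold stereoDenom
  fun_prop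

theorem pd_stereoDenom {n : ℕ} (x : Fin 2 ⊕ Fin n → ℝ) (i : Fin 2 ⊕ Fin n) :
    pd i stereoDenom x = Sum.elim (fun _ => 0) (fun l => 2 * x (Sum.inr l)) i := by
  have hq := HasFDerivAt.fun_sum (u := Finset.univ)
    (fun (l : Fin n) _ => (hasFDerivAt_apply (𝕜 := ℝ) (Sum.inr l : Fin 2 ⊕ Fin n) x).pow 2)
  have h := pd_eq_of_hasFDerivAt (hq.const_add 1) i
  unfold stereoDenom
  rw [h]
  rcases i with i | i <;> simp [Pi.single_apply]

/-- The diagonal components of `brMetric`. -/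
noncomputable def brDiag {n : ℕ} (f : ℝ → ℝ) (h : ℝ) : Fin 2 ⊕ Fin n → (Fin 2 ⊕ Fin n → ℝ) → ℝ
  | Sum.inl 0, x => -f (x (Sum.inl 1))
  | Sum.inl 1, x => (f (x (Sum.inl 1)))⁻¹
  | Sum.inr _, x => 4 * h ^ 2 / stereoDenom x ^ 2

theorem brMetric_eq_diagonal {n : ℕ} (f : ℝ → ℝ) (h : ℝ) (x : Fin 2 ⊕ Fin n → ℝ) :
    brMetric n f h x = Matrix.diagonal (fun a => brDiag f h a x) := by
  ext a b
  rcases a with a | a <;> rcases b with b | b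
  · fin_cases a <;> fin_cases b <;> simp [brMetric, brDiag]
  · simp [brMetric]
  · simp [brMetric]
  · simp only [brMetric, Matrix.fromBlocks_apply₂₂, Matrix.smul_apply, sphereMetric_eq, brDiag,
      Matrix.diagonal_apply, Sum.inr.injEq, stereoDenom, smul_eq_mul]
    split_ifs <;> ring

theorem brDiag_ne_zero {n : ℕ} {f : ℝ → ℝ} {h : ℝ} (hh : h ≠ 0) {x : Fin 2 ⊕ Fin n → ℝ}
    (hx : f (x (Sum.inl 1)) ≠ 0) (a : Fin 2 ⊕ Fin n) : brDiag f h a x ≠ 0 := by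
  have := stereoDenom_pos x
  rcases a with a | a
  · fin_cases a <;> simpa [brDiag]
  · simp only [brDiag]; positivity

theorem pd_inv_stereoDenom_sq {n : ℕ} (c : ℝ) (x : Fin 2 ⊕ Fin n → ℝ) (i : Fin 2 ⊕ Fin n) :
    pd i (fun y => c / stereoDenom y ^ 2) x =
      Sum.elim (fun _ => 0) (fun l => -4 * c * x (Sum.inr l) / stereoDenom x ^ 3) i := by
  have hs := (stereoDenom_pos x).ne'
  have hd : HasDerivAt (fun s : ℝ => c / s ^ 2) (-2 * c / stereoDenom x ^ 3) (stereoDenom x) := by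
    refine ((hasDerivAt_const _ c).fun_div (hasDerivAt_pow 2 _) (pow_ne_zero 2 hs)).congr_deriv ?_
    push_cast
    field_simp
    ring
  have h := hd.comp_hasFDerivAt x (differentiableAt_stereoDenom x).hasFDerivAt
  have h' := pd_eq_of_hasFDerivAt h i
  have hp := pd_stereoDenom x i
  rw [pd] at hp
  simp only [Function.comp_def] at h'
  rw [h', smul_apply, hp]
  rcases i with i | i
  · simp
  · simp; ring

/-- The function `y_l / (1 + |y|²)`. -/
noncomputable def stereoCoord {n : ℕ} (l : Fin n) (x : Fin 2 ⊕ Fin n → ℝ) : ℝ := x (Sum.inr l) / stereoDenom x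

theorem differentiableAt_stereoCoord {n : ℕ} (l : Fin n) (x : Fin 2 ⊕ Fin n → ℝ) :
    DifferentiableAt ℝ (stereoCoord l) x := by
  unfold stereoCoord
  have h1 : DifferentiableAt ℝ (fun y : Fin 2 ⊕ Fin n → ℝ => y (Sum.inr l)) x := by fun_prop
  simp only [div_eq_mul_inv]
  exact h1.fun_mul ((differentiableAt_stereoDenom x).fun_inv (stereoDenom_pos x).ne')

/-- The derivative is again a polynomial in the functions `stereoCoord` and `1 / stereoDenom`. As
the Christoffel symbols of the sphere are linear in `stereoCoord`, its curvature reduces to algebra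
in these quantities. -/
theorem pd_stereoCoord {n : ℕ} (l : Fin n) (x : Fin 2 ⊕ Fin n → ℝ) (i : Fin 2 ⊕ Fin n) :
    pd i (stereoCoord l) x = Sum.elim (fun _ => 0) (fun j => (if j = l then 1 / stereoDenom x else 0)
      - 2 * stereoCoord j x * stereoCoord l x) i := by
  have hs := (stereoDenom_pos x).ne'
  have hx := hasFDerivAt_apply (𝕜 := ℝ) (Sum.inr l : Fin 2 ⊕ Fin n) x
  have h := hx.mul
    ((hasDerivAt_inv hs).comp_hasFDerivAt x (differentiableAt_stereoDenom x).hasFDerivAt)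
  have h' := pd_eq_of_hasFDerivAt h i
  have hp := pd_stereoDenom x i
  rw [pd] at hp
  have e : stereoCoord l = fun x => x (Sum.inr l) * (Inv.inv ∘ stereoDenom) x := by
    funext y
    rw [stereoCoord, div_eq_mul_inv, Function.comp]
  rw [e]
  erw [h']
  simp only [add_apply, smul_apply, hp, ContinuousLinearMap.proj_apply,
    Pi.single_apply, smul_eq_mul, Function.comp]
  rcases i with i | i
  · simp
  · simp [stereoCoord, eq_comm (a := l)]
    split_ifs
    · field_simp; ring
    · field_simp; ring

/-- This is |y|² = (1 + |y|²) - 1 divided by (1 + |y|²)²; it is the only relation among these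
functions that the curvature computation needs. -/
theorem sum_stereoCoord_sq {n : ℕ} (x : Fin 2 ⊕ Fin n → ℝ) :
    ∑ l, stereoCoord l x * stereoCoord l x = 1 / stereoDenom x - 1 / stereoDenom x ^ 2 := by
  have hs := (stereoDenom_pos x).ne'
  have : ∀ l, stereoCoord l x * stereoCoord l x = x (Sum.inr l) ^ 2 * (1 / stereoDenom x ^ 2) := by
    intro l; rw [stereoCoord]; field_simp
  rw [Finset.sum_congr rfl fun l _ => this l, ← Finset.sum_mul]
  have e : ∑ l, x (Sum.inr l) ^ 2 = stereoDenom x - 1 := by rw [stereoDenom]; ring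
  rw [e]
  field_simp

/-! ### Christoffel symbols and curvature of the product metric -/

/-- Christoffel symbols of `-f dt² + f⁻¹ dr²`. -/
noncomputable def lorentzChristoffel (f : ℝ → ℝ) : Fin 2 → Fin 2 → Fin 2 → ℝ → ℝ
  | 0, 0, 0, _ => 0
  | 0, 0, 1, r => deriv f r / (2 * f r)
  | 0, 1, 0, r => deriv f r / (2 * f r)
  | 0, 1, 1, _ => 0
  | 1, 0, 0, r => f r * deriv f r / 2
  | 1, 0, 1, _ => 0
  | 1, 1, 0, _ => 0
  | 1, 1, 1, r => -(deriv f r / (2 * f r))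

/-- Christoffel symbols of `brMetric`. -/
noncomputable def brChristoffel {n : ℕ} (f : ℝ → ℝ) :
    Fin 2 ⊕ Fin n → Fin 2 ⊕ Fin n → Fin 2 ⊕ Fin n → (Fin 2 ⊕ Fin n → ℝ) → ℝ
  | Sum.inl i, Sum.inl j, Sum.inl k, x => lorentzChristoffel f i j k (x (Sum.inl 1))
  | Sum.inr i, Sum.inr j, Sum.inr k, x => -2 * (if i = k then 1 else 0) * stereoCoord j x
      - 2 * (if i = j then 1 else 0) * stereoCoord k x
      + 2 * (if j = k then 1 else 0) * stereoCoord i x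
  | _, _, _, _ => 0

theorem pd_brDiag {n : ℕ} {f : ℝ → ℝ} {h : ℝ} {x : Fin 2 ⊕ Fin n → ℝ}
    (hx : f (x (Sum.inl 1)) ≠ 0) (hf : DifferentiableAt ℝ f (x (Sum.inl 1)))
    (i a : Fin 2 ⊕ Fin n) : pd i (brDiag f h a) x =
      match a, i with
      | Sum.inl 0, Sum.inl 1 => -deriv f (x (Sum.inl 1))
      | Sum.inl 1, Sum.inl 1 => -deriv f (x (Sum.inl 1)) / f (x (Sum.inl 1)) ^ 2
      | Sum.inr _, Sum.inr l => -16 * h ^ 2 * x (Sum.inr l) / stereoDenom x ^ 3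
      | _, _ => 0 := by
  rcases a with a | a
  · fin_cases a
    · have := pd_comp_apply (j := (Sum.inl 1 : Fin 2 ⊕ Fin n)) hf.hasDerivAt.neg i
      refine Eq.trans this ?_
      rcases i with i | i
      · fin_cases i <;> simp
      · simp
    · have := pd_comp_apply (j := (Sum.inl 1 : Fin 2 ⊕ Fin n)) (hf.hasDerivAt.inv hx) i
      refine Eq.trans this ?_
      rcases i with i | i
      · fin_cases i <;> simp
      · simp
  · refine Eq.trans (pd_inv_stereoDenom_sq (4 * h ^ 2) x i) ?_
    rcases i with i | i
    · simp
    · simp only [Sum.elim_inr]; ring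

theorem christoffel_brMetric {n : ℕ} {f : ℝ → ℝ} {h : ℝ} (hh : h ≠ 0) {x : Fin 2 ⊕ Fin n → ℝ}
    (hx : f (x (Sum.inl 1)) ≠ 0) (hf : DifferentiableAt ℝ f (x (Sum.inl 1)))
    (a b c : Fin 2 ⊕ Fin n) :
    christoffel (brMetric n f h) a b c x = brChristoffel f a b c x := by
  have hs := (stereoDenom_pos x).ne'
  rw [christoffel_diagonal (brMetric_eq_diagonal f h) (brDiag_ne_zero hh hx)]
  simp only [pd_brDiag hx hf]
  rcases a with a | a <;> rcases b with b | b <;> rcases c with c | c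
  · fin_cases a <;> fin_cases b <;> fin_cases c <;>
      simp [brChristoffel, lorentzChristoffel, brDiag] <;> field_simp
  all_goals try (simp [brChristoffel]; done)
  · simp only [brChristoffel, brDiag, Sum.inr.injEq, stereoCoord]
    split_ifs <;> field_simp <;> ring

/-- The sectional curvatures of the coordinate planes of `-f dt² + f⁻¹ dr² + h² dΩ²_n`, where `κ` is
the curvature of the `t`-`r` plane and `μ` that of the sphere. -/
def productCurvature {n : ℕ} (κ μ : ℝ) : Fin 2 ⊕ Fin n → Fin 2 ⊕ Fin n → ℝ
  | Sum.inl i, Sum.inl j => if i = j then 0 else κ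
  | Sum.inr i, Sum.inr j => if i = j then 0 else μ
  | _, _ => 0

theorem pd_lorentzChristoffel {n : ℕ} {f : ℝ → ℝ} {x : Fin 2 ⊕ Fin n → ℝ}
    (hx : f (x (Sum.inl 1)) ≠ 0) (hf : DifferentiableAt ℝ f (x (Sum.inl 1)))
    (hf' : DifferentiableAt ℝ (deriv f) (x (Sum.inl 1))) (a b c : Fin 2) (i : Fin 2 ⊕ Fin n) :
    pd i (fun y => lorentzChristoffel f a b c (y (Sum.inl 1))) x =
      if i = Sum.inl 1 then
        (match a, b, c with
        | 0, 0, 0 => 0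
        | 0, 0, 1 => deriv (deriv f) (x (Sum.inl 1)) / (2 * f (x (Sum.inl 1)))
            - deriv f (x (Sum.inl 1)) ^ 2 / (2 * f (x (Sum.inl 1)) ^ 2)
        | 0, 1, 0 => deriv (deriv f) (x (Sum.inl 1)) / (2 * f (x (Sum.inl 1)))
            - deriv f (x (Sum.inl 1)) ^ 2 / (2 * f (x (Sum.inl 1)) ^ 2)
        | 0, 1, 1 => 0
        | 1, 0, 0 => (deriv f (x (Sum.inl 1)) ^ 2
            + f (x (Sum.inl 1)) * deriv (deriv f) (x (Sum.inl 1))) / 2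
        | 1, 0, 1 => 0
        | 1, 1, 0 => 0
        | 1, 1, 1 => -(deriv (deriv f) (x (Sum.inl 1)) / (2 * f (x (Sum.inl 1)))
            - deriv f (x (Sum.inl 1)) ^ 2 / (2 * f (x (Sum.inl 1)) ^ 2)))
      else 0 := by
  have h1 : HasDerivAt (fun r => deriv f r / (2 * f r))
      (deriv (deriv f) (x (Sum.inl 1)) / (2 * f (x (Sum.inl 1)))
            - deriv f (x (Sum.inl 1)) ^ 2 / (2 * f (x (Sum.inl 1)) ^ 2)) (x (Sum.inl 1)) := by
    refine (hf'.hasDerivAt.fun_div (hf.hasDerivAt.const_mul 2) (by positivity)).congr_deriv ?_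
    field_simp
  have h2 : HasDerivAt (fun r => f r * deriv f r / 2) ((deriv f (x (Sum.inl 1)) ^ 2
            + f (x (Sum.inl 1)) * deriv (deriv f) (x (Sum.inl 1))) / 2) (x (Sum.inl 1)) := by
    refine ((hf.hasDerivAt.fun_mul hf'.hasDerivAt).div_const 2).congr_deriv ?_
    ring
  have h0 : HasDerivAt (fun _ : ℝ => (0 : ℝ)) 0 (x (Sum.inl 1)) := hasDerivAt_const _ _
  fin_cases a <;> fin_cases b <;> fin_cases c
  · exact pd_comp_apply h0 i
  · exact pd_comp_apply h1 i
  · exact pd_comp_apply h1 i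
  · exact pd_comp_apply h0 i
  · exact pd_comp_apply h2 i
  · exact pd_comp_apply h0 i
  · exact pd_comp_apply h0 i
  · exact pd_comp_apply h1.fun_neg i

theorem pd_brChristoffel_inr {n : ℕ} (f : ℝ → ℝ) (x : Fin 2 ⊕ Fin n → ℝ) (a b c : Fin n)
    (i : Fin 2 ⊕ Fin n) :
    pd i (brChristoffel f (Sum.inr a) (Sum.inr b) (Sum.inr c)) x =
      -2 * (if a = c then 1 else 0) * pd i (stereoCoord b) x
      - 2 * (if a = b then 1 else 0) * pd i (stereoCoord c) x
      + 2 * (if b = c then 1 else 0) * pd i (stereoCoord a) x := by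
  have hd := fun l : Fin n => (differentiableAt_stereoCoord l x).hasFDerivAt
  exact pd_eq_of_hasFDerivAt ((((hd b).const_mul (-2 * (if a = c then 1 else 0))).sub
    ((hd c).const_mul (2 * (if a = b then 1 else 0)))).add
    ((hd a).const_mul (2 * (if b = c then 1 else 0)))) i

theorem sum_brChristoffel_inr {n : ℕ} (f : ℝ → ℝ) (x : Fin 2 ⊕ Fin n → ℝ) (a b c d : Fin n) :
    ∑ e, brChristoffel f (Sum.inr a) (Sum.inr c) (Sum.inr e) x *
      brChristoffel f (Sum.inr e) (Sum.inr d) (Sum.inr b) x =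
    4 * ((if a = b then 1 else 0) * (stereoCoord c x * stereoCoord d x)
      + (if a = d then 1 else 0) * (stereoCoord c x * stereoCoord b x)
      - (if b = d then 1 else 0) * (stereoCoord c x * stereoCoord a x)
      + 2 * (if a = c then 1 else 0) * (stereoCoord b x * stereoCoord d x)
      - (if a = c then 1 else 0) * (if b = d then 1 else 0) *
        (1 / stereoDenom x - 1 / stereoDenom x ^ 2)
      - (if b = c then 1 else 0) * (stereoCoord a x * stereoCoord d x)
      - (if c = d then 1 else 0) * (stereoCoord a x * stereoCoord b x)
      + (if b = d then 1 else 0) * (stereoCoord a x * stereoCoord c x)) := by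
  -- The summand is sorted by the Kronecker delta that fixes e. The only term without one is a
  -- multiple of `stereoCoord e x * stereoCoord e x`, which `sum_stereoCoord_sq` evaluates.
  have h : ∀ e, brChristoffel f (Sum.inr a) (Sum.inr c) (Sum.inr e) x *
      brChristoffel f (Sum.inr e) (Sum.inr d) (Sum.inr b) x =
      4 * ((if a = e then (if e = b then stereoCoord c x * stereoCoord d x else 0)
        + (if e = d then stereoCoord c x * stereoCoord b x else 0)
        - (if b = d then 1 else 0) * (stereoCoord c x * stereoCoord e x) else 0)
      + (if e = b then (if a = c then 1 else 0) * (stereoCoord e x * stereoCoord d x) else 0)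
      + (if e = d then (if a = c then 1 else 0) * (stereoCoord e x * stereoCoord b x) else 0)
      - (if a = c then 1 else 0) * (if b = d then 1 else 0) * (stereoCoord e x * stereoCoord e x)
      - (if e = c then (if e = b then stereoCoord a x * stereoCoord d x else 0)
        + (if e = d then stereoCoord a x * stereoCoord b x else 0)
        - (if b = d then 1 else 0) * (stereoCoord a x * stereoCoord e x) else 0)) := by
    intro e
    simp only [brChristoffel, eq_comm (a := c) (b := e), eq_comm (a := d) (b := b)]
    split_ifs <;> ring
  simp only [h, ← Finset.mul_sum, Finset.sum_add_distrib, Finset.sum_sub_distrib,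
    Finset.sum_ite_eq, Finset.sum_ite_eq', Finset.mem_univ, if_true, sum_stereoCoord_sq,
    eq_comm (a := c) (b := b)]
  split_ifs <;> ring

/-- No Christoffel symbol mixes the two factors, so curvature components with mixed indices vanish.
The t-r block has curvature -f''/2, and the sphere of radius |h| has 1/h². -/
theorem hasDiagonalCurvature_brMetric {n : ℕ} {f : ℝ → ℝ} {h : ℝ} (hh : h ≠ 0)
    {x : Fin 2 ⊕ Fin n → ℝ} (hx : f (x (Sum.inl 1)) ≠ 0)
    (hf : ∀ᶠ r in nhds (x (Sum.inl 1)), DifferentiableAt ℝ f r)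
    (hf' : DifferentiableAt ℝ (deriv f) (x (Sum.inl 1))) :
    HasDiagonalCurvature (brMetric n f h) x (fun a => brDiag f h a x)
      (productCurvature (-deriv (deriv f) (x (Sum.inl 1)) / 2) (1 / h ^ 2)) where
  ne_zero := brDiag_ne_zero hh hx
  metric := brMetric_eq_diagonal f h x
  symm a b := by
    rcases a with a | a <;> rcases b with b | b <;> simp [productCurvature, eq_comm]
  self a := by rcases a with a | a <;> simp [productCurvature]
  riemann a b c d := by
    have hs := (stereoDenom_pos x).ne'
    have hfx := hf.self_of_nhds
    -- The Riemann tensor differentiates the Christoffel symbols, so they must be known on a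
    -- neighbourhood of x; f ≠ 0 persists there by continuity.
    have hc : ∀ a b c, christoffel (brMetric n f h) a b c =ᶠ[nhds x] brChristoffel f a b c := by
      intro a b c
      have ht : Filter.Tendsto (fun y : Fin 2 ⊕ Fin n → ℝ => y (Sum.inl 1)) (nhds x)
          (nhds (x (Sum.inl 1))) := (continuous_apply _).continuousAt
      filter_upwards [ht.eventually hf, ht.eventually (hfx.continuousAt.eventually_ne hx)]
        with y h1 h2
      exact christoffel_brMetric hh h2 h1 a b c
    have hp := fun a b c i => pd_congr (hc a b c) i
    have hv := fun a b c => (hc a b c).self_of_nhds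
    have hL := fun a b c (i : Fin 2 ⊕ Fin n) => pd_lorentzChristoffel hx hfx hf' a b c i
    have hL' : ∀ a b c (i : Fin 2 ⊕ Fin n),
        pd i (brChristoffel f (Sum.inl a) (Sum.inl b) (Sum.inl c)) x =
        pd i (fun y => lorentzChristoffel f a b c (y (Sum.inl 1))) x := fun _ _ _ _ => rfl
    have hS := fun a b c (i : Fin 2 ⊕ Fin n) => pd_brChristoffel_inr f x a b c i
    have z1 : ∀ (a b : Fin 2) (c : Fin n),
        brChristoffel f (Sum.inl a) (Sum.inl b) (Sum.inr c) = fun _ => 0 := fun _ _ _ => rfl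
    have z2 : ∀ (a c : Fin 2) (b : Fin n),
        brChristoffel f (Sum.inl a) (Sum.inr b) (Sum.inl c) = fun _ => 0 := fun _ _ _ => rfl
    have z3 : ∀ (a : Fin 2) (b c : Fin n),
        brChristoffel f (Sum.inl a) (Sum.inr b) (Sum.inr c) = fun _ => 0 := fun _ _ _ => rfl
    have z4 : ∀ (a : Fin n) (b c : Fin 2),
        brChristoffel f (Sum.inr a) (Sum.inl b) (Sum.inl c) = fun _ => 0 := fun _ _ _ => rfl
    have z5 : ∀ (a c : Fin n) (b : Fin 2),
        brChristoffel f (Sum.inr a) (Sum.inl b) (Sum.inr c) = fun _ => 0 := fun _ _ _ => rfl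
    have z6 : ∀ (a b : Fin n) (c : Fin 2),
        brChristoffel f (Sum.inr a) (Sum.inr b) (Sum.inl c) = fun _ => 0 := fun _ _ _ => rfl
    simp only [EGB.riemann, hp, hv, Fintype.sum_sum_type]
    rcases a with a | a <;> rcases b with b | b <;> rcases c with c | c <;> rcases d with d | d <;>
      simp only [z1, z2, z3, z4, z5, z6, pd_const, hL', hL, hS, pd_stereoCoord, productCurvature,
        Sum.elim_inl, Sum.elim_inr, mul_zero, zero_mul, sub_zero, Finset.sum_const_zero, add_zero,
        zero_add, reduceCtorEq, if_false, ite_self, Sum.inl.injEq, Sum.inr.injEq,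
        Finset.sum_sub_distrib, sum_brChristoffel_inr, Fin.sum_univ_two]
    · fin_cases a <;> fin_cases b <;> fin_cases c <;> fin_cases d <;>
        simp [brChristoffel, lorentzChristoffel, brDiag] <;> field_simp <;> ring
    · simp only [brDiag, eq_comm (a := d) (b := b), eq_comm (a := d) (b := c),
        eq_comm (a := d) (b := a), eq_comm (a := c) (b := b), eq_comm (a := c) (b := a)]
      -- The values of `stereoCoord` stay opaque, so each case is a rational identity whose only
      -- denominators are s and h.
      generalize stereoDenom x = s at hs ⊢
      split_ifs <;> subst_vars <;> first | contradiction | (field_simp; ring)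

/-! ### Reduction of the field equations to two scalar equations -/

theorem sum_productCurvature_inl {n : ℕ} (κ μ : ℝ) (i : Fin 2) :
    ∑ c : Fin 2 ⊕ Fin n, productCurvature κ μ (Sum.inl i) c = κ := by
  fin_cases i <;> simp [productCurvature]

theorem sum_productCurvature_inr {n : ℕ} (κ μ : ℝ) (i : Fin n) :
    ∑ c : Fin 2 ⊕ Fin n, productCurvature κ μ (Sum.inr i) c = (n - 1) * μ := by
  have h : ∀ j : Fin n, (if i = j then 0 else μ) = μ - if i = j then μ else 0 := by
    intro j; split_ifs <;> ring
  simp [productCurvature, h]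
  ring

theorem productCurvature_sq {n : ℕ} (κ μ : ℝ) (a b : Fin 2 ⊕ Fin n) :
    productCurvature κ μ a b ^ 2 = productCurvature (κ ^ 2) (μ ^ 2) a b := by
  rcases a with a | a <;> rcases b with b | b <;> simp [productCurvature]

/-- Row sums of `productCurvature` are constant on each factor. Weighting by such a function only
rescales the two curvatures, so the contraction of Riemann with Ricci is again a row sum. -/
theorem sum_productCurvature_mul {n : ℕ} (κ μ p q : ℝ) (a : Fin 2 ⊕ Fin n) :
    ∑ b, productCurvature κ μ a b * Sum.elim (fun _ => p) (fun _ => q) b =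
      ∑ b, productCurvature (κ * p) (μ * q) a b := by
  refine Finset.sum_congr rfl fun b _ => ?_
  rcases a with a | a <;> rcases b with b | b <;> simp [productCurvature]

theorem sum_productCurvature {n : ℕ} (κ μ : ℝ) (a : Fin 2 ⊕ Fin n) :
    ∑ c, productCurvature κ μ a c = Sum.elim (fun _ => κ) (fun _ => (n - 1) * μ) a := by
  rcases a with a | a
  · exact sum_productCurvature_inl κ μ a
  · exact sum_productCurvature_inr κ μ a

/-- The t and r components give the first equation, the sphere components the second. Positivity of
n guarantees that there is a sphere component at all. -/
theorem fieldEquationsAt_brMetric_iff {n : ℕ} (hn : 0 < n) {f : ℝ → ℝ} {h : ℝ} (hh : h ≠ 0)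
    {x : Fin 2 ⊕ Fin n → ℝ} (hx : f (x (Sum.inl 1)) ≠ 0)
    (hf : ∀ᶠ r in nhds (x (Sum.inl 1)), DifferentiableAt ℝ f r)
    (hf' : DifferentiableAt ℝ (deriv f) (x (Sum.inl 1))) (α C k : ℝ) :
    FieldEquationsAt (brMetric n f h) α (brStress n C k) x ↔
      2 * C * h ^ 4 - (n - 1) * n * h ^ 2 - α * n * (n - 1) * (n - 2) * (n - 3) = 0 ∧
      h ^ 2 * (h ^ 2 + 2 * α * (n - 1) * (n - 2)) * deriv (deriv f) (x (Sum.inl 1))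
          - (n - 1) * (n - 2) * h ^ 2 - α * (n - 1) * (n - 2) * (n - 3) * (n - 4)
          = 2 * k * C * h ^ 4 := by
  have H := hasDiagonalCurvature_brMetric hh hx hf hf'
  rw [brStress, H.fieldEquationsAt_iff]
  generalize deriv (deriv f) (x (Sum.inl 1)) = D
  simp only [productCurvature_sq, sum_productCurvature, sum_productCurvature_mul]
  simp only [Fintype.sum_sum_type, Sum.elim_inl, Sum.elim_inr, Finset.sum_const, Finset.card_univ,
    Fintype.card_fin, nsmul_eq_mul, Sum.forall, forall_const]
  have hne : Nonempty (Fin n) := ⟨⟨0, hn⟩⟩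
  simp only [forall_const]
  have h4 : h ^ 4 ≠ 0 := pow_ne_zero 4 hh
  -- The factor 2h⁴ clears the halves and the denominators of the sphere curvature 1/h² and its
  -- square.
  refine and_congr ⟨fun e => ?_, fun e => ?_⟩ ⟨fun e => ?_, fun e => ?_⟩
  · linear_combination (norm := (field_simp; ring)) 2 * h ^ 4 * e
  · apply mul_left_cancel₀ h4
    linear_combination (norm := (field_simp; ring)) 1 / 2 * e
  · linear_combination (norm := (field_simp; ring)) (2 * h ^ 4) * e
  · apply mul_left_cancel₀ h4
    linear_combination (norm := (field_simp; ring)) (1 / 2) * e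

/-! ### Passing the zeros of f, and integrating the equation -/

theorem deriv_deriv_eq_zero_of_eventuallyEq_zero {f : ℝ → ℝ} {r : ℝ} (h : f =ᶠ[nhds r] fun _ => 0) :
    deriv (deriv f) r = 0 := by
  rw [h.deriv.deriv_eq]
  simp

/-- On an interval, if `f'' = c` wherever `f ≠ 0`, then `f'' = c` everywhere, unless `f = 0`. -/
theorem deriv_deriv_eq_of_ne_zero {f : ℝ → ℝ} {I : Set ℝ} {c : ℝ} (hIo : IsOpen I)
    (hIc : IsPreconnected I) (hf' : ContinuousOn (deriv (deriv f)) I)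
    (hf0 : ∃ r ∈ I, f r ≠ 0) (h : ∀ r ∈ I, f r ≠ 0 → deriv (deriv f) r = c) :
    ∀ r ∈ I, deriv (deriv f) r = c := by
  have hor : ∀ r ∈ I, deriv (deriv f) r = c ∨ deriv (deriv f) r = 0 := by
    intro r hr
    by_cases hz : f =ᶠ[nhds r] fun _ => 0
    · exact Or.inr (deriv_deriv_eq_zero_of_eventuallyEq_zero hz)
    · left
      have hfr : ∃ᶠ s in nhds r, f s ≠ 0 := Filter.not_eventually.1 hz
      have hfr' : ∃ᶠ s in nhds r, deriv (deriv f) s = c :=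
        (hfr.and_eventually (hIo.mem_nhds hr)).mono fun s hs => h s hs.2 hs.1
      by_contra hne
      exact hfr' ((hf'.continuousAt (hIo.mem_nhds hr)).eventually_ne hne)
  by_cases hc : c = 0
  · intro r hr
    rcases hor r hr with h1 | h1
    · exact h1
    · rw [h1, hc]
  obtain ⟨r₀, hr₀, hfr₀⟩ := hf0
  intro r hr
  refine (hor r hr).resolve_right fun hr0 => ?_
  -- The image of I under f'' is connected and lies in a finite set, so it is a single point;
  -- comparison with r₀ gives 0 = c, which is excluded here.
  have him := hIc.image _ hf'
  have hsub : deriv (deriv f) '' I ⊆ {c, 0} := by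
    rintro _ ⟨s, hs, rfl⟩
    exact hor s hs
  have hss := ((Set.toFinite _).subset hsub).countable.isTotallyDisconnected _ subset_rfl him
  have := hss ⟨r, hr, rfl⟩ ⟨r₀, hr₀, rfl⟩
  rw [hr0, h r₀ hr₀ hfr₀] at this
  exact hc this.symm

/-- On a connected open set, functions with equal derivatives differ by a constant. Applied first to
f' and then to f, this produces C₁ and C₂. -/
theorem eq_quadratic_iff_deriv_deriv_eq {f : ℝ → ℝ} {I : Set ℝ} (c : ℝ) (hIo : IsOpen I)
    (hIc : IsPreconnected I) (hf : DifferentiableOn ℝ f I)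
    (hf' : DifferentiableOn ℝ (deriv f) I) :
    (∀ r ∈ I, deriv (deriv f) r = 2 * c) ↔
      ∃ C₁ C₂ : ℝ, ∀ r ∈ I, f r = c * r ^ 2 + C₁ * r + C₂ := by
  constructor
  · intro h
    obtain ⟨C₁, h1⟩ := hIo.exists_eq_add_of_deriv_eq hIc hf'
      (g := fun r => 2 * c * r) (by fun_prop) (fun r hr => by
        rw [h r hr, deriv_const_mul_field, deriv_id'', mul_one])
    obtain ⟨C₂, h2⟩ := hIo.exists_eq_add_of_deriv_eq hIc hf
      (g := fun r => c * r ^ 2 + C₁ * r) (by fun_prop) (fun r hr => by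
        rw [h1 hr]
        have := ((hasDerivAt_pow 2 r).const_mul c).fun_add ((hasDerivAt_id r).const_mul C₁)
        refine Eq.trans ?_ this.deriv.symm
        push_cast
        ring)
    exact ⟨C₁, C₂, fun r hr => h2 hr⟩
  · rintro ⟨C₁, C₂, h⟩ r hr
    have h1 : ∀ s ∈ I, deriv f s = 2 * c * s + C₁ := by
      intro s hs
      have e : f =ᶠ[nhds s] fun r => c * r ^ 2 + C₁ * r + C₂ :=
        Filter.eventually_of_mem (hIo.mem_nhds hs) h
      have := (((hasDerivAt_pow 2 s).const_mul c).fun_add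
        ((hasDerivAt_id s).const_mul C₁)).add_const C₂
      rw [e.deriv_eq]
      refine Eq.trans this.deriv ?_
      push_cast
      ring
    have e : deriv f =ᶠ[nhds r] fun s => 2 * c * s + C₁ :=
      Filter.eventually_of_mem (hIo.mem_nhds hr) h1
    rw [e.deriv_eq]
    simp

/-! ### The equivalences on the whole interval -/

theorem solvesEGB_iff {N : ℕ} (hN : 3 ≤ N) {α C k h : ℝ} (hh : h ≠ 0) {f : ℝ → ℝ} {I : Set ℝ}
    (hIo : IsOpen I) (hIc : IsPreconnected I) (hf : ContDiffOn ℝ 2 f I)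
    (hf0 : ∃ r ∈ I, f r ≠ 0) :
    SolvesEGB N α C k h f I ↔
      2 * C * h ^ 4 - (N - 3) * (N - 2) * h ^ 2
          - α * (N - 2) * (N - 3) * (N - 4) * (N - 5) = 0 ∧
        ∀ r ∈ I, h ^ 2 * (h ^ 2 + 2 * α * (N - 3) * (N - 4)) * deriv (deriv f) r
          - (N - 3) * (N - 4) * h ^ 2 - α * (N - 3) * (N - 4) * (N - 5) * (N - 6)
          = 2 * k * C * h ^ 4 := by
  have hd := (contDiffOn_succ_iff_deriv_of_isOpen (n := 1) hIo).1 hf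
  have hd' := (contDiffOn_succ_iff_deriv_of_isOpen (n := 0) hIo).1 hd.2.2
  have hdd : ContinuousOn (deriv (deriv f)) I := hd'.2.2.continuousOn
  have hcast : ((N - 2 : ℕ) : ℝ) = N - 2 := by
    rw [Nat.cast_sub (by omega)]; norm_num
  have hpt : ∀ x : Fin 2 ⊕ Fin (N - 2) → ℝ, x (Sum.inl 1) ∈ I → f (x (Sum.inl 1)) ≠ 0 →
      (FieldEquationsAt (brMetric (N - 2) f h) α (brStress (N - 2) C k) x ↔
      2 * C * h ^ 4 - (N - 3) * (N - 2) * h ^ 2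
          - α * (N - 2) * (N - 3) * (N - 4) * (N - 5) = 0 ∧
      h ^ 2 * (h ^ 2 + 2 * α * (N - 3) * (N - 4)) * deriv (deriv f) (x (Sum.inl 1))
          - (N - 3) * (N - 4) * h ^ 2 - α * (N - 3) * (N - 4) * (N - 5) * (N - 6)
          = 2 * k * C * h ^ 4) := by
    intro x hxI hx
    have hnhds := hIo.mem_nhds hxI
    rw [fieldEquationsAt_brMetric_iff (by omega) hh hx
      (Filter.eventually_of_mem hnhds fun r hr => hd.1.differentiableAt (hIo.mem_nhds hr))
      (hd'.1.differentiableAt hnhds), hcast]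
    ring_nf
  constructor
  · intro hS
    -- The reduced equations depend on the point only through r, so one point over each r suffices;
    -- all its other coordinates are set to 0.
    have key : ∀ r ∈ I, f r ≠ 0 → _ := fun r hr hfr =>
      (hpt (fun a => if a = Sum.inl 1 then r else 0) (by simpa using hr) (by simpa using hfr)).1
        (hS _ (by simpa using hr) (by simpa using hfr))
    simp only [if_true] at key
    obtain ⟨r₀, hr₀, hfr₀⟩ := hf0
    refine ⟨(key r₀ hr₀ hfr₀).1, ?_⟩
    -- If the coefficient of f'' vanishes, the equation does not involve r, and its validity at r₀
    -- gives it everywhere. Otherwise it determines f'' wherever f ≠ 0.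
    by_cases hA : h ^ 2 * (h ^ 2 + 2 * α * ((N : ℝ) - 3) * (N - 4)) = 0
    · intro r _
      have := (key r₀ hr₀ hfr₀).2
      rw [hA] at this ⊢
      linear_combination this
    · have hconst := deriv_deriv_eq_of_ne_zero hIo hIc hdd ⟨r₀, hr₀, hfr₀⟩
        (c := deriv (deriv f) r₀) (fun r hr hfr => mul_left_cancel₀ hA (by
          linear_combination (key r hr hfr).2 - (key r₀ hr₀ hfr₀).2))
      intro r hr
      rw [hconst r hr]
      exact (key r₀ hr₀ hfr₀).2
  · rintro ⟨h1, h2⟩ x hxI hx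
    exact (hpt x hxI hx).2 ⟨h1, h2 _ hxI⟩

end EGB

theorem mainTheorem3 (N : ℕ) (hN : 3 ≤ N) (α C k h : ℝ) (hh : h ≠ 0) (f : ℝ → ℝ) (I : Set ℝ)
    (hIo : IsOpen I) (hIc : IsPreconnected I) (hf : ContDiffOn ℝ 2 f I)
    (hf0 : ∃ r ∈ I, f r ≠ 0) :
    -- the field equations reduce to an algebraic constraint on `h` and a second order equation
    (EGB.SolvesEGB N α C k h f I ↔
      2 * C * h ^ 4 - (N - 3) * (N - 2) * h ^ 2
          - α * (N - 2) * (N - 3) * (N - 4) * (N - 5) = 0 ∧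
        ∀ r ∈ I, h ^ 2 * (h ^ 2 + 2 * α * (N - 3) * (N - 4)) * deriv (deriv f) r
          - (N - 3) * (N - 4) * h ^ 2 - α * (N - 3) * (N - 4) * (N - 5) * (N - 6)
          = 2 * k * C * h ^ 4) ∧
    -- and the solutions are exactly these quadratic polynomials
    (h ^ 2 + 2 * α * (N - 3) * (N - 4) ≠ 0 →
      (EGB.SolvesEGB N α C k h f I ↔
        2 * C * h ^ 4 - (N - 3) * (N - 2) * h ^ 2
            - α * (N - 2) * (N - 3) * (N - 4) * (N - 5) = 0 ∧
          ∃ C₁ C₂ : ℝ, ∀ r ∈ I,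
            f r = (2 * k * C * h ^ 4 + (N - 3) * (N - 4) * h ^ 2
                  + α * (N - 3) * (N - 4) * (N - 5) * (N - 6))
                / (2 * h ^ 2 * (h ^ 2 + 2 * α * (N - 3) * (N - 4))) * r ^ 2
              + C₁ * r + C₂)) := by
  have hd := (contDiffOn_succ_iff_deriv_of_isOpen (n := 1) hIo).1 hf
  have hd' := hd.2.2.differentiableOn one_ne_zero
  have hS := EGB.solvesEGB_iff hN (α := α) (C := C) (k := k) hh hIo hIc hf hf0
  refine ⟨hS, fun hA => hS.trans (and_congr_right fun _ => ?_)⟩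
  rw [← EGB.eq_quadratic_iff_deriv_deriv_eq _ hIo hIc hd.1 hd']
  -- As a single nonzero symbol A, this factor can be cancelled from the r² coefficient, which is
  -- half of f''.
  generalize h ^ 2 + 2 * α * ((N : ℝ) - 3) * (N - 4) = A at hA ⊢
  refine forall₂_congr fun r _ => ⟨fun e => ?_, fun e => ?_⟩
  · field_simp
    linear_combination e
  · rw [e]
    field_simp
    ring
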